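/- \textbf{Setting.} Let $\Theta\subseteq\mathbb R^p$ and, for $\theta\in\Theta$, let $\mathcal U_{\theta,1}\subset\mathbb R^d$ be convex and compact with $0$ in its interior. Let $s_\theta$ be the gauge of $\mathcal U_{\theta,1}$, $\mathcal U_{\theta,\rho}=\{u:s_\theta(u)\le\rho\}$ for $\rho>0$, and $\sigma_K(w)=\sup_{u\in K}\langle w,u\rangle$. Let $\mathcal X\subseteq\mathbb R^{n_x}$ be closed and convex, $f:\mathbb R^{n_x}\to\mathbb R\cup\{+\infty\}$ and $a_1,\dots,a_m:\mathbb R^{n_x}\to\mathbb R$ convex, $w_j\in\mathbb R^d$, $b_j\in\mathbb R$, and put \[V(\theta,\rho)=\inf\{f(x):x\in\mathcal X,\ a_j(x)+\sigma_{\mathcal U_{\theta,\rho}}(w_j)\le b_j,\ j=1,\dots,m\}\qquad(\inf\emptyset=+\infty).\] A dual optimizer at $(\theta,\rho)$ is a maximizer over $\mu\in\mathbb R^m_{\ge0}$ of $q(\mu;\theta,\rho)=\inf_{x\in\mathcal X}\big[f(x)+\sum_j\mu_j(a_j(x)+\sigma_{\mathcal U_{\theta,\rho}}(w_j)-b_j)\big]$.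 Fix $\tau\in(0,1)$, $\varepsilon>0$, an interior point $\theta$ of $\Theta$, a probability measure $P$ on $\mathbb R^d$, and $\Phi:\mathbb R\to[0,1]$. With $U\sim P$, for every shape $\vartheta\in\Theta$ let $F_{\vartheta,\varepsilon}(r)=\mathbb E\,\Phi((r-s_\vartheta(U))/\varepsilon)$, $\rho_{P,\varepsilon}(\vartheta)=\inf\{r:F_{\vartheta,\varepsilon}(r)\ge\tau\}$ and $J_{P,\varepsilon}(\vartheta)=V(\vartheta,\rho_{P,\varepsilon}(\vartheta))$. Write $\rho:=\rho_{P,\varepsilon}(\theta)$ and suppose $\rho>0$. For tuning data $U_1,\dots,U_n$ ($n=n_{\mathrm{tune}}$) let $\hat F(r)=\frac1n\sum_{i=1}^n\Phi((r-s_\theta(U_i))/\varepsilon)$, $\hat\rho=\inf\{r:\hat F(r)\ge\tau\}$, $\omega_i=\Phi'((\hat\rho-s_\theta(U_i))/\varepsilon)$, and \[\hat g_\varepsilon(\theta)=\sum_{j=1}^m\mu_j^*\,\nabla_\theta\sigma_{\mathcal U_{\theta,r}}(w_j)\big|_{r=\hat\rho}+\Big(\sum_{j=1}^m\mu_j^*\,\sigma_{\mathcal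 U_{\theta,1}}(w_j)\Big)\,\frac{\sum_{i=1}^n\omega_i\nabla_\theta s_\theta(U_i)}{\sum_{i=1}^n\omega_i},\] where $\mu^*$ is a dual optimizer at $(\theta,\hat\rho)$, chosen in any way (an arbitrary vector if $\hat\rho\le 0$ or no dual optimizer exists). \textbf{Theorem (Consistency).} Assume: \begin{itemize} \item[(A1)] $U_1,U_2,\dots$ are i.i.d. with law $P$. \item[(A2)] $\Phi$ is $C^1$ and nondecreasing with $\Phi(-\infty)=0$, $\Phi(+\infty)=1$, and $\Phi'$ is bounded, uniformly continuous and strictly positive. For every $u$ the map $\vartheta\mapsto s_\vartheta(u)$ is $C^1$ on the interior of $\Theta$, and there is a $P$-integrable $M$ such that for $P$-almost every $u$, $\|\nabla_\vartheta s_\vartheta(u)\|\le M(u)$ for all $\vartheta$ in the interior of $\Theta$. \item[(A3)] $F_{\theta,\varepsilon}$ is strictly increasing near $\rho$ and $\partial_rF_{\theta,\varepsilon}(\rho)>0$. \item[(A4)] $V$ is finite near $(\theta,\rho)$ and differentiable at $(\theta,\rho)$; in a neighbourhood of $(\theta,\rho)$ the dual optimizer exists, is unique and depends continuously on $(\theta',\rho')$.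 \item[(A5)] For each $j$, $\nabla_{\theta'}\sigma_{\mathcal U_{\theta',\rho'}}(w_j)$ exists and is continuous in $(\theta',\rho')$ in a neighbourhood of $(\theta,\rho)$. \end{itemize} Then $J_{P,\varepsilon}$ is finite near $\theta$ and differentiable at $\theta$, and $\hat g_\varepsilon(\theta)\to\nabla_\theta J_{P,\varepsilon}(\theta)$ in probability as $n\to\infty$. -/

import Mathlib

open Filter Topology MeasureTheory ProbabilityTheory

noncomputable section

namespace ReserveLearning

/-- Euclidean space `ℝⁿ`. -/
abbrev Vec (n : ℕ) : Type := EuclideanSpace ℝ (Fin n)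

/-! Uncertainty sets. The shape-dependent family is given by its unit sets `C θ`. -/

/-- For every `θ ∈ Θ` the unit set is convex, compact, with `0` in its interior
(in particular nonempty). -/
structure GaugeRegular {p d : ℕ} (C : Vec p → Set (Vec d)) (Θ : Set (Vec p)) : Prop where
  convex : ∀ θ ∈ Θ, Convex ℝ (C θ)
  isCompact : ∀ θ ∈ Θ, IsCompact (C θ)
  zero_mem_interior : ∀ θ ∈ Θ, (0 : Vec d) ∈ interior (C θ)

/-- The score `s_θ(u)`: the gauge (Minkowski functional) of the unit set. -/
def score {p d : ℕ} (C : Vec p → Set (Vec d)) (θ : Vec p) (u : Vec d) : ℝ :=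
  gauge (C θ) u

/-- The uncertainty set `𝒰_{θ,ρ} = {u : s_θ(u) ≤ ρ}`, used for `ρ > 0`. -/
def uncertaintySet {p d : ℕ} (C : Vec p → Set (Vec d)) (θ : Vec p) (ρ : ℝ) : Set (Vec d) :=
  {u | score C θ u ≤ ρ}

/-- The support function `σ_K(w) = sup_{u ∈ K} ⟪w, u⟫` (of a nonempty bounded set `K`). -/
def supportFn {d : ℕ} (K : Set (Vec d)) (w : Vec d) : ℝ :=
  sSup ((fun u => inner ℝ w u) '' K)

/-! The robust convex program. -/

/-- Data of the robust program: a closed convex decision set `X`, a convex objective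
`f : ℝ^{n_x} → ℝ ∪ {+∞}`, convex constraint functions `a j`, exposure vectors `w j`, and
right-hand sides `b j`. -/
structure RobustProgram (d nx m : ℕ) where
  X : Set (Vec nx)
  f : Vec nx → EReal
  a : Fin m → Vec nx → ℝ
  w : Fin m → Vec d
  b : Fin m → ℝ
  isClosed_X : IsClosed X
  convex_X : Convex ℝ X
  f_ne_bot : ∀ x, f x ≠ ⊥
  /-- `f` is convex: its epigraph is a convex set. -/
  convex_f : Convex ℝ {z : Vec nx × ℝ | f z.1 ≤ (z.2 : EReal)}
  convex_a : ∀ j, ConvexOn ℝ Set.univ (a j)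

namespace RobustProgram

variable {p d nx m : ℕ}

/-- `σ_{𝒰_{θ,ρ}}(w_j)`. -/
def sigma (Q : RobustProgram d nx m) (C : Vec p → Set (Vec d)) (j : Fin m)
    (θ : Vec p) (ρ : ℝ) : ℝ :=
  supportFn (uncertaintySet C θ ρ) (Q.w j)

/-- The points `x ∈ X` with `a_j(x) + σ_{𝒰_{θ,ρ}}(w_j) ≤ b_j` for all `j`. -/
def feasible (Q : RobustProgram d nx m) (C : Vec p → Set (Vec d)) (θ : Vec p) (ρ : ℝ) :
    Set (Vec nx) :=
  {x | x ∈ Q.X ∧ ∀ j, Q.a j x + Q.sigma C j θ ρ ≤ Q.b j}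

/-- The robust value function `V(θ,ρ)`; it is `+∞` if no point is feasible. -/
def value (Q : RobustProgram d nx m) (C : Vec p → Set (Vec d)) (θ : Vec p) (ρ : ℝ) : EReal :=
  ⨅ x ∈ Q.feasible C θ ρ, Q.f x

/-- The Lagrange dual function
`q(ν;θ,ρ) = inf_{x ∈ X} [f(x) + ∑_j ν_j (a_j(x) + σ_{𝒰_{θ,ρ}}(w_j) - b_j)]`. -/
def dual (Q : RobustProgram d nx m) (C : Vec p → Set (Vec d)) (θ : Vec p) (ρ : ℝ)
    (ν : Fin m → ℝ) : EReal :=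
  ⨅ x ∈ Q.X, Q.f x + ((∑ j, ν j * (Q.a j x + Q.sigma C j θ ρ - Q.b j) : ℝ) : EReal)

/-- The set `ℳ*(θ,ρ)` of optimal dual multipliers, the maximizers of the dual function
over `ν ≥ 0`. -/
def optDual (Q : RobustProgram d nx m) (C : Vec p → Set (Vec d)) (θ : Vec p) (ρ : ℝ) :
    Set (Fin m → ℝ) :=
  {ν | 0 ≤ ν ∧ ∀ ν' : Fin m → ℝ, 0 ≤ ν' → Q.dual C θ ρ ν' ≤ Q.dual C θ ρ ν}

end RobustProgram

/-! Smoothing and the tuning-based estimator. -/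

/-- A smoothing CDF: `Φ : ℝ → [0,1]` is `C¹`, nondecreasing, with limits `0` and `1` at `∓∞`,
and `φ = Φ'` is bounded, uniformly continuous and strictly positive. -/
structure IsSmoothingCDF (Φ : ℝ → ℝ) : Prop where
  mem_Icc : ∀ x, Φ x ∈ Set.Icc (0 : ℝ) 1
  contDiff : ContDiff ℝ 1 Φ
  monotone : Monotone Φ
  tendsto_atBot : Tendsto Φ atBot (𝓝 0)
  tendsto_atTop : Tendsto Φ atTop (𝓝 1)
  bounded : ∃ B : ℝ, ∀ x, |deriv Φ x| ≤ B
  uniformContinuous : UniformContinuous (deriv Φ)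
  pos : ∀ x, 0 < deriv Φ x

/-- `θ ↦ s_θ(u)` is `C¹` for every `u`, and almost surely `‖∇_θ s_θ(U)‖ ≤ M(U)` for all shapes,
for one integrable `M`. -/
structure ScoreDifferentiable {p d : ℕ} (C : Vec p → Set (Vec d)) (Θ : Set (Vec p))
    (P : Measure (Vec d)) : Prop where
  contDiffOn : ∀ u, ContDiffOn ℝ 1 (fun t => score C t u) (interior Θ)
  dominated : ∃ M : Vec d → ℝ, Integrable M P ∧
    ∀ᵐ u ∂P, ∀ t ∈ interior Θ, ‖gradient (fun t' => score C t' u) t‖ ≤ M u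

variable {p d nx m : ℕ}

/-- The smoothed population CDF `F_{θ,ε}(r) = 𝔼[Φ((r - s_θ(U))/ε)]`, `U ∼ P`. -/
def smoothedCDF (C : Vec p → Set (Vec d)) (P : Measure (Vec d)) (Φ : ℝ → ℝ) (ε : ℝ)
    (θ : Vec p) (r : ℝ) : ℝ :=
  ∫ u, Φ ((r - score C θ u) / ε) ∂P

/-- The smoothed population radius `ρ_{P,ε}(θ) = inf {r : F_{θ,ε}(r) ≥ τ}`. -/
def smoothedRadius (C : Vec p → Set (Vec d)) (P : Measure (Vec d)) (Φ : ℝ → ℝ) (ε τ : ℝ)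
    (θ : Vec p) : ℝ :=
  sInf {r | τ ≤ smoothedCDF C P Φ ε θ r}

/-- The smoothed profiled objective `J_{P,ε}(θ) = V(θ, ρ_{P,ε}(θ))`. -/
def smoothedObjective (Q : RobustProgram d nx m) (C : Vec p → Set (Vec d)) (P : Measure (Vec d))
    (Φ : ℝ → ℝ) (ε τ : ℝ) (θ : Vec p) : EReal :=
  Q.value C θ (smoothedRadius C P Φ ε τ θ)

/-- The empirical smoothed CDF of the tuning data `u 0, …, u (n - 1)`. -/
def empCDF (C : Vec p → Set (Vec d)) (Φ : ℝ → ℝ) (ε : ℝ) (θ : Vec p)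
    (n : ℕ) (u : ℕ → Vec d) (r : ℝ) : ℝ :=
  (∑ i ∈ Finset.range n, Φ ((r - score C θ (u i)) / ε)) / n

/-- The empirical smoothed radius `ρ̂_ε(θ) = inf {r : F̂_{θ,ε}(r) ≥ τ}`. -/
def empRadius (C : Vec p → Set (Vec d)) (Φ : ℝ → ℝ) (ε τ : ℝ) (θ : Vec p)
    (n : ℕ) (u : ℕ → Vec d) : ℝ :=
  sInf {r | τ ≤ empCDF C Φ ε θ n u r}

/-- The kernel weights `ω_i(θ) = φ((ρ̂_ε(θ) - s_θ(u_i))/ε)`, `φ = Φ'`. -/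
def kernelWeight (C : Vec p → Set (Vec d)) (Φ : ℝ → ℝ) (ε τ : ℝ) (θ : Vec p)
    (n : ℕ) (u : ℕ → Vec d) (i : ℕ) : ℝ :=
  deriv Φ ((empRadius C Φ ε τ θ n u - score C θ (u i)) / ε)

/-- The empirical quantile sensitivity `∑ ω_i ∇_θ s_θ(u_i) / ∑ ω_i`. -/
def empSensitivity (C : Vec p → Set (Vec d)) (Φ : ℝ → ℝ) (ε τ : ℝ) (θ : Vec p)
    (n : ℕ) (u : ℕ → Vec d) : Vec p :=
  (∑ i ∈ Finset.range n, kernelWeight C Φ ε τ θ n u i)⁻¹ •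
    ∑ i ∈ Finset.range n,
      kernelWeight C Φ ε τ θ n u i • gradient (fun t => score C t (u i)) θ

/-- The tuned gradient estimator `ĝ_ε(θ)` computed from the tuning data `u 0, …, u (n - 1)` and
from dual multipliers `ν` of the robust program at `(θ, ρ̂_ε(θ))`. In the envelope term the
radius is held fixed at `ρ̂_ε(θ)`. -/
def tunedGradient (Q : RobustProgram d nx m) (C : Vec p → Set (Vec d)) (Φ : ℝ → ℝ) (ε τ : ℝ)
    (θ : Vec p) (n : ℕ) (u : ℕ → Vec d) (ν : Fin m → ℝ) : Vec p :=
  (∑ j, ν j • gradient (fun t => Q.sigma C j t (empRadius C Φ ε τ θ n u)) θ) +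
    (∑ j, ν j * Q.sigma C j θ 1) • empSensitivity C Φ ε τ θ n u

end ReserveLearning

end

open ReserveLearning

/-! The estimator is the chain rule for `V(t, ρ(t))` with population quantities replaced by sample
ones.

Population side: `F(t, ρ(t)) = τ` holds near `θ`, so implicit differentiation
(`hasFDerivAt_of_implicit`) gives `∇ρ = E[φ ∇s] / E[φ]`. For `V`, no Slater condition is assumed: a
vertical separating functional would yield a direction along which the dual optimizer can be moved,
so its uniqueness forces strong duality (`value_le_dual_of_optDual_eq_singleton`). Weak duality with
that multiplier at nearby parameters then gives a minorant of `V` touching it at `(θ, ρ)`; as `V` is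
differentiable there, the two derivatives agree (`hasFDerivAt_value`).

Sample side: the law of large numbers at fixed radii and monotonicity give `ρ̂ → ρ`
(`tendsto_sInf_of_tendsto`); uniform continuity of `φ` lets `ρ̂` replace `ρ` in the kernel averages
(`tendsto_kernel_average`). Continuity of the multiplier and of the support gradients does the rest.
Convergence in probability is expressed through a filter, so continuous mapping is composition of
limits, and neither `ρ̂` nor the chosen multipliers need be measurable. -/

namespace ReserveLearning

/-! ### Convergence in probability as convergence along a filter -/

/-- The filter on `ℕ × Ω` of the sequences of events whose probability tends to one. -/
def inProbability {Ω : Type*} [MeasurableSpace Ω] (μ : Measure Ω) : Filter (ℕ × Ω) where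
  sets := {S | Tendsto (fun n => μ {ω | (n, ω) ∉ S}) atTop (𝓝 0)}
  univ_sets := by simp
  sets_of_superset {S T} hS hST := by
    refine tendsto_of_tendsto_of_tendsto_of_le_of_le tendsto_const_nhds hS
      (fun _ => zero_le) fun n => measure_mono fun ω hω hωS => hω (hST hωS)
  inter_sets {S T} hS hT := by
    have h := Tendsto.add (f := fun n => μ {ω | (n, ω) ∉ S}) hS hT
    rw [add_zero] at h
    refine tendsto_of_tendsto_of_tendsto_of_le_of_le tendsto_const_nhds h
      (fun _ => zero_le) fun n => (measure_mono fun ω hω => ?_).trans (measure_union_le _ _)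
    by_contra hc
    simp only [Set.mem_union, Set.mem_ofPred_eq, not_or, not_not] at hc
    exact hω hc

theorem tendstoInMeasure_const_iff {Ω E : Type*} [MeasurableSpace Ω] [PseudoEMetricSpace E]
    {μ : Measure Ω} {f : ℕ → Ω → E} {c : E} :
    TendstoInMeasure μ f atTop (fun _ => c) ↔
      Tendsto (fun z : ℕ × Ω => f z.1 z.2) (inProbability μ) (𝓝 c) := by
  rw [Metric.nhds_basis_eball.tendsto_right_iff]
  refine forall₂_congr fun ε _ => ?_
  change _ ↔ Tendsto (fun n => μ {ω | ¬ edist (f n ω) c < ε}) atTop (𝓝 0)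
  simp only [not_lt]

/-- The weak law of large numbers for functions of an i.i.d. sequence. -/
theorem tendsto_average_inProbability {Ω 𝓧 E : Type*} [MeasurableSpace Ω] [MeasurableSpace 𝓧]
    [NormedAddCommGroup E] [NormedSpace ℝ E] [CompleteSpace E] [MeasurableSpace E] [BorelSpace E]
    {μ : Measure Ω} [IsProbabilityMeasure μ] {P : Measure 𝓧} {U : ℕ → Ω → 𝓧}
    (hU : ∀ i, Measurable (U i)) (hindep : iIndepFun U μ) (hlaw : ∀ i, Measure.map (U i) μ = P)
    {g : 𝓧 → E} (hg : Measurable g) (hint : Integrable g P) :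
    Tendsto (fun z : ℕ × Ω => (z.1 : ℝ)⁻¹ • ∑ i ∈ Finset.range z.1, g (U i z.2))
      (inProbability μ) (𝓝 (∫ u, g u ∂P)) := by
  have hgU : ∀ i, Integrable (fun ω => g (U i ω)) μ := fun i => by
    rw [← hlaw i] at hint
    exact hint.comp_measurable (hU i)
  have hmeas : ∀ n : ℕ, AEStronglyMeasurable
      (fun ω => (n : ℝ)⁻¹ • ∑ i ∈ Finset.range n, g (U i ω)) μ := fun n =>
    (integrable_finsetSum _ fun i _ => hgU i).aestronglyMeasurable.const_smul _
  have hpair : Pairwise (Function.onFun (fun X Y => IndepFun X Y μ) fun i ω => g (U i ω)) :=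
    fun i j hij => (hindep.indepFun hij).comp hg hg
  have hident : ∀ i, IdentDistrib (fun ω => g (U i ω)) (fun ω => g (U 0 ω)) μ μ := fun i =>
    (IdentDistrib.mk (hU i).aemeasurable (hU 0).aemeasurable
      ((hlaw i).trans (hlaw 0).symm)).comp hg
  have hintU : Integrable g (Measure.map (U 0) μ) := (hlaw 0).symm ▸ hint
  have he : ∫ u, g u ∂P = ∫ ω, g (U 0 ω) ∂μ := by
    rw [← integral_map (hU 0).aemeasurable hintU.aestronglyMeasurable, hlaw 0]
  have h := strong_law_ae (fun i ω => g (U i ω)) (hgU 0) hpair hident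
  rw [← he] at h
  exact (tendstoInMeasure_const_iff
    (f := fun (n : ℕ) ω => (n : ℝ)⁻¹ • ∑ i ∈ Finset.range n, g (U i ω))).1
    (tendstoInMeasure_of_tendsto_ae hmeas h)

/-! ### Generalized quantiles -/

/-- Monotonicity traps the infimum between two fixed levels `a < ρ < b` as soon as `G i a < τ < G i
b`, so pointwise convergence suffices. It serves both for shapes tending to `t` and for growing
samples. -/
theorem tendsto_sInf_of_tendsto {ι : Type*} {l : Filter ι} {G : ι → ℝ → ℝ} {F : ℝ → ℝ} {τ ρ : ℝ}
    (hmono : ∀ᶠ i in l, Monotone (G i)) (hlim : ∀ r, Tendsto (fun i => G i r) l (𝓝 (F r)))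
    (hlt : ∀ r < ρ, F r < τ) (hgt : ∀ r, ρ < r → τ < F r) :
    Tendsto (fun i => sInf {r | τ ≤ G i r}) l (𝓝 ρ) := by
  have key : ∀ a b, a < ρ → ρ < b → ∀ᶠ i in l, sInf {r | τ ≤ G i r} ∈ Set.Icc a b := by
    intro a b ha hb
    filter_upwards [hmono, (hlim a).eventually_lt_const (hlt a ha),
      (hlim b).eventually_const_lt (hgt b hb)] with i hm hia hib
    have hlb : a ∈ lowerBounds {r | τ ≤ G i r} := fun r hr => by
      by_contra hra
      exact absurd (hr.trans (hm (not_le.1 hra).le)) (not_le.2 hia)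
    exact ⟨le_csInf ⟨b, hib.le⟩ hlb, csInf_le ⟨a, hlb⟩ hib.le⟩
  rw [tendsto_order]
  constructor
  · intro a ha
    obtain ⟨c, hac, hc⟩ := exists_between ha
    filter_upwards [key c (ρ + 1) hc (by linarith)] with i hi using hac.trans_le hi.1
  · intro b hb
    obtain ⟨c, hc, hcb⟩ := exists_between hb
    filter_upwards [key (ρ - 1) c (by linarith) hc] with i hi using hi.2.trans_lt hcb

/-- A continuous function takes the value `τ` at a positive generalized quantile:
positivity rules out the junk value of `sInf`. -/
theorem quantile_spec {G : ℝ → ℝ} {τ : ℝ} (hcont : Continuous G)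
    (hpos : 0 < sInf {r | τ ≤ G r}) :
    G (sInf {r | τ ≤ G r}) = τ ∧ ∀ r < sInf {r | τ ≤ G r}, G r < τ := by
  have hne : {r | τ ≤ G r}.Nonempty := by
    by_contra h
    rw [Set.not_nonempty_iff_eq_empty.1 h, Real.sInf_empty] at hpos
    exact hpos.false
  have hbdd : BddBelow {r | τ ≤ G r} := by
    by_contra h
    rw [Real.sInf_of_not_bddBelow h] at hpos
    exact hpos.false
  have hlt : ∀ r < sInf {r | τ ≤ G r}, G r < τ := fun r hr => by
    by_contra h
    exact absurd (csInf_le hbdd (not_lt.1 h)) (not_le.2 hr)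
  refine ⟨le_antisymm ?_ ?_, hlt⟩
  · have h : Tendsto G (𝓝[<] sInf {r | τ ≤ G r}) (𝓝 (G (sInf {r | τ ≤ G r}))) :=
      hcont.continuousAt.tendsto.mono_left nhdsWithin_le_nhds
    exact le_of_tendsto h (eventually_nhdsWithin_of_forall fun r hr => (hlt r hr).le)
  · exact (isClosed_le continuous_const hcont).csInf_mem hne hbdd

/-! ### Implicit differentiation -/

/-- `F` is differentiable at a single point only, so the implicit function theorem does not apply;
continuity of `g` replaces it. The map `(t, y) ↦ (t, F (t, y))` sends the graph of `g` to `(t, c)`,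
and its derivative has a left inverse. -/
theorem hasFDerivAt_of_implicit {E : Type*} [NormedAddCommGroup E] [NormedSpace ℝ E]
    {F : E × ℝ → ℝ} {F' : E × ℝ →L[ℝ] ℝ} {g : E → ℝ} {a : E} {c : ℝ}
    (hF : HasFDerivAt F F' (a, g a)) (hg : ContinuousAt g a) (h0 : F' (0, 1) ≠ 0)
    (hc : ∀ᶠ t in 𝓝 a, F (t, g t) = c) :
    HasFDerivAt g (-((F' (0, 1))⁻¹ • F'.comp (ContinuousLinearMap.inl ℝ E ℝ))) a := by
  have hadd : ∀ z : E × ℝ, F' z = F' (z.1, 0) + z.2 * F' (0, 1) := fun z => by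
    rw [← smul_eq_mul, ← map_smul, ← map_add]
    simp
  -- `S` solves `F' (v, s) = y` for `s`, namely `s = (y - F' (v, 0)) / F' (0, 1)`.
  let S : E × ℝ →L[ℝ] E × ℝ := (ContinuousLinearMap.fst ℝ E ℝ).prod
    ((F' (0, 1))⁻¹ • (ContinuousLinearMap.snd ℝ E ℝ -
      (F'.comp (ContinuousLinearMap.inl ℝ E ℝ)).comp (ContinuousLinearMap.fst ℝ E ℝ)))
  have h := HasFDerivAt.of_comp_of_leftInverse (g := fun t => (t, g t))
    (f := fun z : E × ℝ => (z.1, F z)) (h := fun t => (t, c)) (f'symm := S)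
    (continuousAt_id.prodMk hg) (hasFDerivAt_fst.prodMk hF)
    ((hasFDerivAt_id a).prodMk (hasFDerivAt_const c a))
    (by filter_upwards [hc] with t ht; simp [ht])
    (fun z => by
      ext1
      · simp [S]
      · simp only [S, ContinuousLinearMap.prod_apply, ContinuousLinearMap.coe_fst',
          smul_apply, sub_apply,
          ContinuousLinearMap.coe_snd', ContinuousLinearMap.comp_apply,
          ContinuousLinearMap.inl_apply, smul_eq_mul]
        rw [hadd z]
        field_simp
        ring)
  refine h.snd.congr_fderiv ?_
  ext v
  simp [S]

/-! ### Lagrangian duality -/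

namespace RobustProgram

variable {p d nx m : ℕ}

-- Positive homogeneity of the gauge. It supplies the derivative of the support functions in the
-- radius, about which nothing is assumed.
open scoped Pointwise in
theorem sigma_eq_mul (Q : RobustProgram d nx m) (C : Vec p → Set (Vec d)) (j : Fin m)
    (t : Vec p) {r : ℝ} (hr : 0 < r) : Q.sigma C j t r = r * Q.sigma C j t 1 := by
  have hset : (fun u => inner ℝ (Q.w j) u) '' uncertaintySet C t r =
      r • ((fun u => inner ℝ (Q.w j) u) '' uncertaintySet C t 1) := by
    ext y
    simp only [Set.mem_image, Set.mem_smul_set, uncertaintySet, score, Set.mem_ofPred_eq]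
    constructor
    · rintro ⟨u, hu, rfl⟩
      refine ⟨_, ⟨r⁻¹ • u, ?_, rfl⟩, ?_⟩
      · rw [gauge_smul_of_nonneg (inv_nonneg.2 hr.le), smul_eq_mul]
        exact (inv_mul_le_one₀ hr).2 hu
      · rw [inner_smul_right, smul_eq_mul, mul_inv_cancel_left₀ hr.ne']
    · rintro ⟨_, ⟨u, hu, rfl⟩, rfl⟩
      refine ⟨r • u, ?_, by rw [inner_smul_right, smul_eq_mul]⟩
      rw [gauge_smul_of_nonneg hr.le, smul_eq_mul]
      exact mul_le_of_le_one_right hr.le hu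
  simp only [sigma, supportFn]
  rw [hset, Real.sSup_smul_of_nonneg hr.le, smul_eq_mul]

theorem nonneg_of_forall_le_add_mul {a b B : ℝ}
    (h : ∀ T : ℝ, 0 ≤ T → b ≤ B + T * a) : 0 ≤ a := by
  by_contra! ha
  have h0 := h 0 le_rfl
  -- This `T` makes `B + T * a = b - 1`; it is nonnegative by the case `T = 0`.
  have h1 := h ((B - b + 1) / (-a)) (div_nonneg (by linarith) (by linarith))
  have : (B - b + 1) / (-a) * a = -(B - b + 1) := by
    rw [div_neg, neg_mul, div_mul_cancel₀ _ ha.ne]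
  linarith

/-- Supporting multipliers `(l, k) ≥ 0` of the perturbed epigraph at `(0, v)`, where `v` is the
optimal value. -/
theorem exists_multiplier (Q : RobustProgram d nx m) {y : Fin m → ℝ} {v : ℝ}
    (hv : (⨅ x ∈ {x | x ∈ Q.X ∧ ∀ j, Q.a j x + y j ≤ Q.b j}, Q.f x) = (v : EReal)) :
    ∃ (l : Fin m → ℝ) (k : ℝ), 0 ≤ l ∧ 0 ≤ k ∧ (l ≠ 0 ∨ k ≠ 0) ∧
      ∀ x ∈ Q.X, ∀ c : ℝ, Q.f x ≤ c →
        k * v ≤ (∑ j, l j * (Q.a j x + y j - Q.b j)) + k * c := by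
  set g : Vec nx → Fin m → ℝ := fun x j => Q.a j x + y j - Q.b j with hg
  -- The strict inequalities make `A` open with no continuity of `f` or `a j`, so Hahn-Banach
  -- separates it from `(0, v)`.
  let A : Set ((Fin m → ℝ) × ℝ) :=
    {z | ∃ x ∈ Q.X, Q.f x < (z.2 : EReal) ∧ ∀ j, g x j < z.1 j}
  obtain ⟨x₀, hx₀X, c₀, hx₀⟩ : ∃ x ∈ Q.X, ∃ c : ℝ, Q.f x ≤ c := by
    by_contra! h
    have : (⨅ x ∈ {x | x ∈ Q.X ∧ ∀ j, Q.a j x + y j ≤ Q.b j}, Q.f x) = ⊤ := by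
      refine iInf₂_eq_top.2 fun x hx => ?_
      by_contra hxt
      refine (h x hx.1 (Q.f x).toReal).not_ge ?_
      rw [EReal.coe_toReal hxt (Q.f_ne_bot x)]
    rw [hv] at this
    exact EReal.coe_ne_top _ this
  have hA_open : IsOpen A := by
    have : A = ⋃ x ∈ Q.X, {z : (Fin m → ℝ) × ℝ | Q.f x < (z.2 : EReal)} ∩
        ⋂ j, {z : (Fin m → ℝ) × ℝ | g x j < z.1 j} := by
      ext z; simp [A, and_left_comm]
    rw [this]
    refine isOpen_biUnion fun x _ => IsOpen.inter ?_ (isOpen_iInter_of_finite fun j => ?_)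
    · exact isOpen_lt continuous_const (continuous_coe_real_ereal.comp continuous_snd)
    · exact isOpen_lt continuous_const ((continuous_apply j).comp continuous_fst)
  have hA_conv : Convex ℝ A := by
    rintro z₁ ⟨x₁, hx₁, hf₁, hg₁⟩ z₂ ⟨x₂, hx₂, hf₂, hg₂⟩ s t hs ht hst
    -- Convexity of `f` is known only through its epigraph, which has real heights; hence the
    -- intermediate reals.
    obtain ⟨c₁, hc₁, hc₁'⟩ := EReal.lt_iff_exists_real_btwn.1 hf₁
    obtain ⟨c₂, hc₂, hc₂'⟩ := EReal.lt_iff_exists_real_btwn.1 hf₂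
    rw [EReal.coe_lt_coe_iff] at hc₁' hc₂'
    have hmix : ∀ {a₁ b₁ a₂ b₂ : ℝ}, a₁ < b₁ → a₂ < b₂ → s * a₁ + t * a₂ < s * b₁ + t * b₂ := by
      intro a₁ b₁ a₂ b₂ h₁ h₂
      rcases hs.eq_or_lt with rfl | hs'
      · obtain rfl : t = 1 := by linarith
        linarith
      · nlinarith
    refine ⟨s • x₁ + t • x₂, Q.convex_X hx₁ hx₂ hs ht hst, ?_, fun j => ?_⟩
    · have h := Q.convex_f (x := (x₁, c₁)) hc₁.le (y := (x₂, c₂)) hc₂.le hs ht hst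
      refine lt_of_le_of_lt h ?_
      exact EReal.coe_lt_coe_iff.2 (hmix hc₁' hc₂')
    · have h := (Q.convex_a j).2 (Set.mem_univ x₁) (Set.mem_univ x₂) hs ht hst
      have h' := hmix (hg₁ j) (hg₂ j)
      simp only [hg, smul_eq_mul, Prod.fst_add, Prod.smul_fst, Pi.add_apply, Pi.smul_apply]
        at h h' ⊢
      have e : s * y j + t * y j = y j := by rw [← add_mul, hst, one_mul]
      have e' : s * Q.b j + t * Q.b j = Q.b j := by rw [← add_mul, hst, one_mul]
      linarith
  have hA_not : ((0 : Fin m → ℝ), v) ∉ A := by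
    rintro ⟨x, hxX, hfx, hgx⟩
    refine hfx.not_ge ?_
    rw [← hv]
    refine iInf₂_le x ⟨hxX, fun j => ?_⟩
    have := hgx j
    simp only [hg, Pi.zero_apply] at this
    linarith
  obtain ⟨φ, hφ⟩ := geometric_hahn_banach_open_point hA_conv hA_open hA_not
  -- `φ` is smaller on `A` than at `(0, v)`, while `A` is unbounded upwards; the sign change makes
  -- the multipliers nonnegative.
  set l : Fin m → ℝ := fun j => -φ (Pi.single j 1, 0) with hl
  set k : ℝ := -φ (0, 1) with hk
  have hφ_eq : ∀ z, φ z = -((∑ j, l j * z.1 j) + k * z.2) := by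
    intro z
    have hz : z = (∑ j, z.1 j • ((Pi.single j 1, 0) : (Fin m → ℝ) × ℝ)) + z.2 • (0, 1) := by
      ext1
      · simp only [Prod.fst_add, Prod.fst_sum, Prod.smul_fst, smul_zero, add_zero]
        exact pi_eq_sum_univ' z.1
      · simp [Prod.snd_sum]
    conv_lhs => rw [hz]
    simp only [map_add, map_sum, map_smul, smul_eq_mul, hl, hk]
    rw [neg_add, ← Finset.sum_neg_distrib]
    congr 1
    · exact Finset.sum_congr rfl fun j _ => by ring
    · ring
  have key : ∀ x ∈ Q.X, ∀ c : ℝ, Q.f x ≤ c → ∀ z : Fin m → ℝ, (∀ j, g x j ≤ z j) →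
      k * v ≤ (∑ j, l j * z j) + k * c := by
    intro x hx c hc z hz
    -- Raising every coordinate by `δ > 0` lands in `A`; letting `δ → 0` gives the non-strict
    -- inequality.
    have hlim : Tendsto (fun δ : ℝ => (∑ j, l j * (z j + δ)) + k * (c + δ)) (𝓝[>] 0)
        (𝓝 ((∑ j, l j * (z j + 0)) + k * (c + 0))) :=
      Tendsto.mono_left (Continuous.tendsto (by fun_prop) 0) nhdsWithin_le_nhds
    simp only [add_zero] at hlim
    refine ge_of_tendsto hlim (eventually_nhdsWithin_of_forall fun δ (hδ : 0 < δ) => ?_)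
    have h := hφ (fun j => z j + δ, c + δ)
      ⟨x, hx, hc.trans_lt (EReal.coe_lt_coe_iff.2 (by linarith)), fun j => by
        have := hz j; simp only; linarith⟩
    rw [hφ_eq, hφ_eq] at h
    simp only [Pi.zero_apply, mul_zero, Finset.sum_const_zero, zero_add] at h
    linarith
  refine ⟨l, k, fun j => ?_, ?_, ?_, fun x hx c hc => key x hx c hc _ fun _ => le_rfl⟩
  · refine nonneg_of_forall_le_add_mul (b := k * v) (B := (∑ i, l i * g x₀ i) + k * c₀)
      fun T hT => ?_
    have h := key x₀ hx₀X c₀ hx₀ (g x₀ + T • Pi.single j 1) fun i => by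
      have : 0 ≤ (Pi.single j 1 : Fin m → ℝ) i := by
        rw [Pi.single_apply]; split_ifs <;> norm_num
      simp only [Pi.add_apply, Pi.smul_apply, smul_eq_mul]
      nlinarith
    have e : ∑ i, l i * (g x₀ + T • Pi.single j 1 : Fin m → ℝ) i =
        (∑ i, l i * g x₀ i) + T * l j := by
      simp only [Pi.add_apply, Pi.smul_apply, smul_eq_mul, mul_add, Finset.sum_add_distrib]
      congr 1
      rw [Finset.sum_eq_single j]
      · simp [mul_comm]
      · intro i _ hij; simp [hij]
      · simp
    rw [e] at h
    linarith
  · refine nonneg_of_forall_le_add_mul (b := k * v) (B := (∑ i, l i * g x₀ i) + k * c₀)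
      fun T hT => ?_
    have h := key x₀ hx₀X (c₀ + T)
      (hx₀.trans (EReal.coe_le_coe_iff.2 (by linarith))) (g x₀) fun _ => le_rfl
    linarith
  · by_contra! h
    have hmem : (fun j => g x₀ j + 1, c₀ + 1) ∈ A :=
      ⟨x₀, hx₀X, hx₀.trans_lt (EReal.coe_lt_coe_iff.2 (by simp)), fun j => by simp⟩
    have h' := hφ _ hmem
    rw [hφ_eq, hφ_eq, h.1, h.2] at h'
    simp at h'

/-- Uniqueness of the dual optimizer forces strong duality. -/
theorem value_le_dual_of_optDual_eq_singleton (Q : RobustProgram d nx m)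
    {C : Vec p → Set (Vec d)} {t : Vec p} {r : ℝ} {ν : Fin m → ℝ}
    (h_top : Q.value C t r ≠ ⊤) (h_bot : Q.value C t r ≠ ⊥) (hν : Q.optDual C t r = {ν}) :
    Q.value C t r ≤ Q.dual C t r ν := by
  obtain ⟨v, hv⟩ : ∃ v : ℝ, Q.value C t r = v :=
    ⟨_, (EReal.coe_toReal h_top h_bot).symm⟩
  obtain ⟨hν0, hνmax⟩ : ν ∈ Q.optDual C t r := hν ▸ rfl
  obtain ⟨l, k, hl, hk, hne, hsupp⟩ := Q.exists_multiplier (y := fun j => Q.sigma C j t r) hv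
  rcases hk.eq_or_lt with rfl | hk
  -- Vertical case `k = 0`: the `l`-weighted sum of constraints is nonnegative wherever `f` is
  -- finite, so `ν + l` is again optimal, contradicting uniqueness.
  · have hl0 : l ≠ 0 := hne.resolve_right (by simp)
    have hle : Q.dual C t r ν ≤ Q.dual C t r (ν + l) := by
      refine le_iInf₂ fun x hx => (iInf₂_le x hx).trans ?_
      by_cases hf : Q.f x = ⊤
      · rw [hf, EReal.top_add_coe, EReal.top_add_coe]
      · have h := hsupp x hx (Q.f x).toReal (EReal.coe_toReal hf (Q.f_ne_bot x)).ge
        refine add_le_add le_rfl (EReal.coe_le_coe_iff.2 ?_)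
        simp only [Pi.add_apply, add_mul, Finset.sum_add_distrib]
        linarith
    have hmem : ν + l ∈ Q.optDual C t r :=
      ⟨add_nonneg hν0 hl, fun ν' hν' => (hνmax ν' hν').trans hle⟩
    rw [hν, Set.mem_singleton_iff, add_eq_left] at hmem
    exact absurd hmem hl0
  -- Here `k > 0`, and the normalized multiplier `k⁻¹ • l` already has dual value at least `v`.
  · refine le_trans ?_ (hνmax (k⁻¹ • l) (smul_nonneg (inv_nonneg.2 hk.le) hl))
    rw [hv]
    refine le_iInf₂ fun x hx => ?_
    by_cases hf : Q.f x = ⊤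
    · rw [hf, EReal.top_add_coe]; exact le_top
    · have h := hsupp x hx (Q.f x).toReal (EReal.coe_toReal hf (Q.f_ne_bot x)).ge
      rw [← EReal.coe_toReal hf (Q.f_ne_bot x), ← EReal.coe_add, EReal.coe_le_coe_iff]
      simp only [Pi.smul_apply, smul_eq_mul, mul_assoc, ← Finset.mul_sum]
      have := mul_le_mul_of_nonneg_left h (inv_nonneg.2 hk.le)
      rwa [mul_add, inv_mul_cancel_left₀ hk.ne', inv_mul_cancel_left₀ hk.ne', add_comm] at this

/-- Weak duality at `(t', r')` with a multiplier that attains the value at `(t, r)`. -/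
theorem add_sum_mul_sigma_sub_le_value (Q : RobustProgram d nx m) {C : Vec p → Set (Vec d)}
    {t : Vec p} {r v : ℝ} {ν : Fin m → ℝ} (hν : 0 ≤ ν) (hv : (v : EReal) ≤ Q.dual C t r ν)
    (t' : Vec p) (r' : ℝ) :
    ((v + ∑ j, ν j * (Q.sigma C j t' r' - Q.sigma C j t r) : ℝ) : EReal) ≤ Q.value C t' r' := by
  refine le_iInf₂ fun x hx => ?_
  by_cases hf : Q.f x = ⊤
  · rw [hf]; exact le_top
  have h := hv.trans (iInf₂_le x hx.1)
  rw [← EReal.coe_toReal hf (Q.f_ne_bot x)] at h ⊢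
  rw [← EReal.coe_add, EReal.coe_le_coe_iff] at h
  rw [EReal.coe_le_coe_iff]
  have hS : ∑ j, ν j * (Q.a j x + Q.sigma C j t' r' - Q.b j) ≤ 0 :=
    Finset.sum_nonpos fun j _ =>
      mul_nonpos_of_nonneg_of_nonpos (hν j) (by have := hx.2 j; linarith)
  have e : ∑ j, ν j * (Q.sigma C j t' r' - Q.sigma C j t r) =
      ∑ j, ν j * (Q.a j x + Q.sigma C j t' r' - Q.b j) -
        ∑ j, ν j * (Q.a j x + Q.sigma C j t r - Q.b j) := by
    rw [← Finset.sum_sub_distrib]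
    exact Finset.sum_congr rfl fun j _ => by ring
  linarith

/-- The envelope theorem for the robust value function. -/
theorem hasFDerivAt_value (Q : RobustProgram d nx m) {C : Vec p → Set (Vec d)}
    {t : Vec p} {r : ℝ} (hr : 0 < r) {ν : Fin m → ℝ}
    (hfin : ∀ᶠ z : Vec p × ℝ in 𝓝 (t, r), Q.value C z.1 z.2 ≠ ⊤ ∧ Q.value C z.1 z.2 ≠ ⊥)
    (hdiff : DifferentiableAt ℝ (fun z : Vec p × ℝ => (Q.value C z.1 z.2).toReal) (t, r))
    (hν : Q.optDual C t r = {ν})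
    (hσ : ∀ j, DifferentiableAt ℝ (fun t' => Q.sigma C j t' r) t) :
    HasFDerivAt (fun z : Vec p × ℝ => (Q.value C z.1 z.2).toReal)
      ((innerSL ℝ (∑ j, ν j • gradient (fun t' => Q.sigma C j t' r) t)).comp
          (ContinuousLinearMap.fst ℝ (Vec p) ℝ) +
        (∑ j, ν j * Q.sigma C j t 1) • ContinuousLinearMap.snd ℝ (Vec p) ℝ) (t, r) := by
  set W : Vec p × ℝ → ℝ := fun z => (Q.value C z.1 z.2).toReal with hW
  have hfin0 := hfin.self_of_nhds
  have hν0 : 0 ≤ ν := (hν ▸ rfl : ν ∈ Q.optDual C t r).1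
  have hdual := Q.value_le_dual_of_optDual_eq_singleton hfin0.1 hfin0.2 hν
  rw [← EReal.coe_toReal hfin0.1 hfin0.2] at hdual
  have hmin : ∀ᶠ z : Vec p × ℝ in 𝓝 (t, r),
      W (t, r) + ∑ j, ν j * (Q.sigma C j z.1 z.2 - Q.sigma C j t r) ≤ W z := by
    filter_upwards [hfin] with z hz
    have h := Q.add_sum_mul_sigma_sub_le_value hν0 hdual z.1 z.2
    rwa [← EReal.coe_toReal hz.1 hz.2, EReal.coe_le_coe_iff] at h
  obtain ⟨D, hD⟩ := hdiff
  -- The support functions are differentiable in the shape at fixed radius, not jointly, so `D` is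
  -- computed on each factor. On each, `W` minus the minorant has a local minimum.
  have hfst : D.comp (ContinuousLinearMap.inl ℝ (Vec p) ℝ) =
      innerSL ℝ (∑ j, ν j • gradient (fun t' => Q.sigma C j t' r) t) := by
    have h1 : HasFDerivAt (fun t' => W (t', r)) (D.comp (ContinuousLinearMap.inl ℝ _ ℝ)) t :=
      HasFDerivAt.comp (f := fun t' => (t', r)) t hD (hasFDerivAt_prodMk_left t r)
    have h2 : HasFDerivAt (fun t' => ∑ j, ν j * (Q.sigma C j t' r - Q.sigma C j t r))
        (∑ j, ν j • innerSL ℝ (gradient (fun t' => Q.sigma C j t' r) t)) t :=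
      HasFDerivAt.fun_sum fun j _ =>
        ((hσ j).hasGradientAt.hasFDerivAt.sub_const _).const_mul (ν j)
    have hloc : IsLocalMin (fun t' => W (t', r) -
        ∑ j, ν j * (Q.sigma C j t' r - Q.sigma C j t r)) t := by
      have hc : Tendsto (fun t' => (t', r)) (𝓝 t) (𝓝 (t, r)) :=
        (Continuous.prodMk_left r).tendsto t
      filter_upwards [hc.eventually hmin] with t' ht'
      simp only [sub_self, mul_zero, Finset.sum_const_zero, sub_zero]
      linarith
    have h0 := hloc.hasFDerivAt_eq_zero (h1.sub h2)
    rw [sub_eq_zero.1 h0]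
    simp
  have hsnd : D (0, 1) = ∑ j, ν j * Q.sigma C j t 1 := by
    have h1 : HasFDerivAt (fun r' => W (t, r')) (D.comp (ContinuousLinearMap.inr ℝ _ ℝ)) r :=
      HasFDerivAt.comp (f := fun r' => (t, r')) r hD (hasFDerivAt_prodMk_right t r)
    have h2 : HasDerivAt (fun r' => (r' - r) * ∑ j, ν j * Q.sigma C j t 1)
        (∑ j, ν j * Q.sigma C j t 1) r := by
      simpa using ((hasDerivAt_id r).sub_const r).mul_const (∑ j, ν j * Q.sigma C j t 1)
    have hloc : IsLocalMin (fun r' => W (t, r') - (r' - r) * ∑ j, ν j * Q.sigma C j t 1) r := by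
      have hc : Tendsto (fun r' => (t, r')) (𝓝 r) (𝓝 (t, r)) :=
        (Continuous.prodMk_right t).tendsto r
      filter_upwards [hc.eventually hmin, lt_mem_nhds hr] with r' hr' hr0
      have e : ∑ j, ν j * (Q.sigma C j t r' - Q.sigma C j t r) =
          (r' - r) * ∑ j, ν j * Q.sigma C j t 1 := by
        rw [Finset.mul_sum]
        refine Finset.sum_congr rfl fun j _ => ?_
        rw [Q.sigma_eq_mul C j t hr, Q.sigma_eq_mul C j t hr0]
        ring
      simp only [e] at hr'
      simp only [sub_self, zero_mul, sub_zero]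
      linarith
    have h0 := hloc.hasDerivAt_eq_zero (h1.hasDerivAt.sub h2)
    simpa using sub_eq_zero.1 h0
  refine hD.congr_fderiv (ContinuousLinearMap.ext fun z => ?_)
  have hz : D z = D.comp (ContinuousLinearMap.inl ℝ (Vec p) ℝ) z.1 + z.2 * D (0, 1) := by
    rw [ContinuousLinearMap.comp_apply, ← smul_eq_mul, ← map_smul, ← map_add]
    simp
  rw [hz, hfst, hsnd]
  simp [mul_comm]

end RobustProgram

/-! ### The smoothed radius as a function of the shape -/

section Population

variable {p d : ℕ} {C : Vec p → Set (Vec d)} {Θ : Set (Vec p)} {P : Measure (Vec d)}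
  {Φ : ℝ → ℝ} {ε τ : ℝ} {t : Vec p} {r : ℝ}

theorem GaugeRegular.continuous_score (hC : GaugeRegular C Θ) (ht : t ∈ Θ) :
    Continuous (score C t) :=
  continuous_gauge (hC.convex t ht) (mem_interior_iff_mem_nhds.1 (hC.zero_mem_interior t ht))

theorem ScoreDifferentiable.differentiableAt (hs : ScoreDifferentiable C Θ P)
    (ht : t ∈ interior Θ) (u : Vec d) : DifferentiableAt ℝ (fun t' => score C t' u) t :=
  ((hs.contDiffOn u).differentiableOn (by simp)).differentiableAt (isOpen_interior.mem_nhds ht)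

/-- Each partial derivative is a pointwise limit of difference quotients, which are continuous in
`u`. Shifting the index by `N` keeps the perturbed shapes in `Θ`. -/
theorem measurable_gradient_score (hC : GaugeRegular C Θ) (hs : ScoreDifferentiable C Θ P)
    (ht : t ∈ interior Θ) : Measurable fun u => gradient (fun t' => score C t' u) t := by
  have hcoord : ∀ i, Measurable fun u => gradient (fun t' => score C t' u) t i := by
    intro i
    set e : Vec p := EuclideanSpace.single i 1
    have hlim : Tendsto (fun n : ℕ => t + ((n : ℝ) + 1)⁻¹ • e) atTop (𝓝 (t + (0 : ℝ) • e)) :=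
      tendsto_const_nhds.add
        (((tendsto_inv_atTop_zero.comp (tendsto_atTop_add_const_right atTop (1 : ℝ)
          tendsto_natCast_atTop_atTop))).smul_const e)
    rw [zero_smul, add_zero] at hlim
    obtain ⟨N, hN⟩ := eventually_atTop.1 (hlim.eventually (isOpen_interior.mem_nhds ht))
    refine measurable_of_tendsto_metrizable (f := fun n u => (((n + N : ℕ) : ℝ) + 1) *
      (score C (t + (((n + N : ℕ) : ℝ) + 1)⁻¹ • e) u - score C t u)) (fun n => ?_) ?_
    · exact ((hC.continuous_score (interior_subset (hN _ (Nat.le_add_left N n)))).measurable.sub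
        (hC.continuous_score (interior_subset ht)).measurable).const_mul _
    · rw [tendsto_pi_nhds]
      intro u
      have hd := (hs.differentiableAt ht u).hasGradientAt.hasFDerivAt
      have h := (hd.lim e (c := fun n : ℕ => (n : ℝ) + 1) (l := atTop) ?_).comp
        (tendsto_add_atTop_nat N)
      · rw [InnerProductSpace.toDual_apply_apply, EuclideanSpace.inner_single_right, one_mul,
          conj_trivial] at h
        exact h
      · exact tendsto_norm_atTop_atTop.comp
          (tendsto_atTop_add_const_right atTop (1 : ℝ) tendsto_natCast_atTop_atTop)
  exact (WithLp.measurable_toLp 2 (Fin p → ℝ)).comp (measurable_pi_iff.2 hcoord)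

/-- The mean kernel weight `𝔼[φ((r - s_t(U))/ε)]`. -/
noncomputable def meanWeight (C : Vec p → Set (Vec d)) (P : Measure (Vec d)) (Φ : ℝ → ℝ) (ε : ℝ)
    (t : Vec p) (r : ℝ) : ℝ :=
  ∫ u, deriv Φ ((r - score C t u) / ε) ∂P

/-- The mean weighted score gradient `𝔼[φ((r - s_t(U))/ε) ∇_t s_t(U)]`. -/
noncomputable def meanWeightedGradient (C : Vec p → Set (Vec d)) (P : Measure (Vec d))
    (Φ : ℝ → ℝ) (ε : ℝ) (t : Vec p) (r : ℝ) : Vec p :=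
  ∫ u, deriv Φ ((r - score C t u) / ε) • gradient (fun t' => score C t' u) t ∂P

theorem IsSmoothingCDF.hasDerivAt (hΦ : IsSmoothingCDF Φ) (x : ℝ) :
    HasDerivAt Φ (deriv Φ x) x :=
  (hΦ.contDiff.differentiable (by simp) x).hasDerivAt

theorem measurable_kernel (hC : GaugeRegular C Θ) (ht : t ∈ Θ) {h : ℝ → ℝ} (hh : Continuous h) :
    Measurable fun u => h ((r - score C t u) / ε) :=
  (hh.comp ((continuous_const.sub (hC.continuous_score ht)).div_const ε)).measurable

theorem integrable_smoothing [IsProbabilityMeasure P] (hC : GaugeRegular C Θ)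
    (hΦ : IsSmoothingCDF Φ) (ht : t ∈ Θ) : Integrable (fun u => Φ ((r - score C t u) / ε)) P :=
  Integrable.of_bound (measurable_kernel hC ht hΦ.contDiff.continuous).aestronglyMeasurable 1
    (Eventually.of_forall fun u => by
      rw [Real.norm_eq_abs, abs_of_nonneg (hΦ.mem_Icc _).1]
      exact (hΦ.mem_Icc _).2)

theorem monotone_smoothedCDF [IsProbabilityMeasure P] (hC : GaugeRegular C Θ)
    (hΦ : IsSmoothingCDF Φ) (hε : 0 < ε) (ht : t ∈ Θ) : Monotone (smoothedCDF C P Φ ε t) :=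
  fun _ _ hrr => integral_mono (integrable_smoothing hC hΦ ht) (integrable_smoothing hC hΦ ht)
    fun _ => hΦ.monotone (by gcongr)

theorem integrable_gradient_score (hC : GaugeRegular C Θ) (hs : ScoreDifferentiable C Θ P)
    (ht : t ∈ interior Θ) : Integrable (fun u => gradient (fun t' => score C t' u) t) P := by
  obtain ⟨M, hM, hdom⟩ := hs.dominated
  exact hM.mono' (measurable_gradient_score hC hs ht).aestronglyMeasurable
    (hdom.mono fun u hu => hu t ht)

theorem integrable_kernel_smul {E : Type*} [NormedAddCommGroup E] [NormedSpace ℝ E]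
    (hC : GaugeRegular C Θ) (hΦ : IsSmoothingCDF Φ) (ht : t ∈ Θ) {g : Vec d → E}
    (hg : Integrable g P) : Integrable (fun u => deriv Φ ((r - score C t u) / ε) • g u) P := by
  obtain ⟨B, hB⟩ := hΦ.bounded
  exact hg.bdd_smul B (measurable_kernel hC ht hΦ.uniformContinuous.continuous).aestronglyMeasurable
    (Eventually.of_forall fun u => hB _)

/-- Differentiation under the integral sign, with dominating function `B * (ε⁻¹ * (1 + M u))`; the
derivative is taken jointly in shape and radius, as implicit differentiation requires. -/
theorem hasFDerivAt_smoothedCDF [IsProbabilityMeasure P] (hC : GaugeRegular C Θ)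
    (hs : ScoreDifferentiable C Θ P) (hΦ : IsSmoothingCDF Φ) (hε : 0 < ε)
    (ht : t ∈ interior Θ) (r : ℝ) :
    HasFDerivAt (fun z : Vec p × ℝ => smoothedCDF C P Φ ε z.1 z.2)
      (ε⁻¹ • (meanWeight C P Φ ε t r • ContinuousLinearMap.snd ℝ (Vec p) ℝ -
        (innerSL ℝ (meanWeightedGradient C P Φ ε t r)).comp
          (ContinuousLinearMap.fst ℝ (Vec p) ℝ))) (t, r) := by
  obtain ⟨B, hB⟩ := hΦ.bounded
  obtain ⟨M, hM, hdom⟩ := hs.dominated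
  have hB0 : 0 ≤ B := (abs_nonneg _).trans (hB 0)
  let F' : Vec p × ℝ → Vec d → Vec p × ℝ →L[ℝ] ℝ := fun z u =>
    deriv Φ ((z.2 - score C z.1 u) / ε) • (ε⁻¹ • (ContinuousLinearMap.snd ℝ (Vec p) ℝ -
      (innerSL ℝ (gradient (fun t' => score C t' u) z.1)).comp
        (ContinuousLinearMap.fst ℝ (Vec p) ℝ)))
  have hnhds : interior Θ ×ˢ (Set.univ : Set ℝ) ∈ 𝓝 (t, r) :=
    prod_mem_nhds (isOpen_interior.mem_nhds ht) univ_mem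
  have htΘ := interior_subset ht
  have hmeas : AEStronglyMeasurable (F' (t, r)) P := by
    refine Measurable.aestronglyMeasurable ?_
    have hcont : Continuous fun v : Vec p => ε⁻¹ • (ContinuousLinearMap.snd ℝ (Vec p) ℝ -
        (innerSL ℝ v).comp (ContinuousLinearMap.fst ℝ (Vec p) ℝ)) := by fun_prop
    exact (measurable_kernel hC htΘ hΦ.uniformContinuous.continuous).smul
      (hcont.measurable.comp (measurable_gradient_score hC hs ht))
  have hbound : ∀ᵐ u ∂P, ∀ z ∈ interior Θ ×ˢ (Set.univ : Set ℝ),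
      ‖F' z u‖ ≤ B * (ε⁻¹ * (1 + M u)) := by
    filter_upwards [hdom] with u hu z hz
    rw [norm_smul, norm_smul, Real.norm_of_nonneg (inv_nonneg.2 hε.le)]
    refine mul_le_mul (hB _) ?_ (by positivity) hB0
    refine mul_le_mul_of_nonneg_left ?_ (inv_nonneg.2 hε.le)
    refine (norm_sub_le _ _).trans (add_le_add (ContinuousLinearMap.norm_snd_le ..) ?_)
    refine (ContinuousLinearMap.opNorm_comp_le _ _).trans ?_
    rw [innerSL_apply_norm]
    refine le_trans ?_ (hu z.1 hz.1)
    exact mul_le_of_le_one_right (norm_nonneg _) (ContinuousLinearMap.norm_fst_le ..)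
  have hbound_int : Integrable (fun u => B * (ε⁻¹ * (1 + M u))) P :=
    (((integrable_const 1).add hM).const_mul _).const_mul _
  have hderiv := hasFDerivAt_integral_of_dominated_of_fderiv_le (μ := P) (𝕜 := ℝ)
    (F := fun (z : Vec p × ℝ) u => Φ ((z.2 - score C z.1 u) / ε)) (F' := F') hnhds
    (by
      filter_upwards [hnhds] with z hz
      exact (measurable_kernel hC (interior_subset hz.1)
        hΦ.contDiff.continuous).aestronglyMeasurable)
    (integrable_smoothing hC hΦ htΘ) hmeas hbound hbound_int
    (Eventually.of_forall fun u z hz => by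
      have h1 : HasFDerivAt (fun z : Vec p × ℝ => score C z.1 u)
          ((innerSL ℝ (gradient (fun t' => score C t' u) z.1)).comp
            (ContinuousLinearMap.fst ℝ (Vec p) ℝ)) z :=
        HasFDerivAt.comp z (hs.differentiableAt hz.1 u).hasGradientAt.hasFDerivAt hasFDerivAt_fst
      have h2 := ((hasFDerivAt_snd (𝕜 := ℝ) (p := z)).sub h1).mul_const ε⁻¹
      exact (hΦ.hasDerivAt _).comp_hasFDerivAt z h2)
  refine hderiv.congr_fderiv (ContinuousLinearMap.ext fun z => ?_)
  have hF'int : Integrable (F' (t, r)) P :=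
    hbound_int.mono' hmeas (hbound.mono fun u hu => hu _ ⟨ht, trivial⟩)
  rw [ContinuousLinearMap.integral_apply hF'int]
  have hw : Integrable (fun u => deriv Φ ((r - score C t u) / ε)) P := by
    simpa using integrable_kernel_smul hC hΦ htΘ (g := fun _ => (1 : ℝ)) (integrable_const _)
  have hwg := integrable_kernel_smul hC hΦ htΘ (r := r) (ε := ε)
    (integrable_gradient_score hC hs ht)
  have e : ∀ u, F' (t, r) u z = ε⁻¹ * (deriv Φ ((r - score C t u) / ε) * z.2 -
      inner ℝ z.1 (deriv Φ ((r - score C t u) / ε) • gradient (fun t' => score C t' u) t)) := by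
    intro u
    simp only [F', smul_apply, sub_apply, ContinuousLinearMap.comp_apply,
      ContinuousLinearMap.coe_fst', ContinuousLinearMap.coe_snd', innerSL_apply_apply,
      smul_eq_mul, inner_smul_right]
    rw [real_inner_comm]
    ring
  simp_rw [e]
  rw [integral_const_mul, integral_sub (hw.mul_const _) (hwg.const_inner _), integral_mul_const,
    integral_inner hwg]
  simp [meanWeight, meanWeightedGradient, real_inner_comm]

/-- The smoothed radius is continuous and differentiable in the shape. -/
theorem hasGradientAt_smoothedRadius [IsProbabilityMeasure P] (hC : GaugeRegular C Θ)
    (hs : ScoreDifferentiable C Θ P) (hΦ : IsSmoothingCDF Φ) (hε : 0 < ε)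
    (ht : t ∈ interior Θ) (hpos : 0 < smoothedRadius C P Φ ε τ t)
    (hgt : ∀ r, smoothedRadius C P Φ ε τ t < r → τ < smoothedCDF C P Φ ε t r)
    (hA : meanWeight C P Φ ε t (smoothedRadius C P Φ ε τ t) ≠ 0) :
    HasGradientAt (smoothedRadius C P Φ ε τ)
      ((meanWeight C P Φ ε t (smoothedRadius C P Φ ε τ t))⁻¹ •
        meanWeightedGradient C P Φ ε t (smoothedRadius C P Φ ε τ t)) t := by
  have hint : ∀ᶠ t' in 𝓝 t, t' ∈ interior Θ := isOpen_interior.mem_nhds ht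
  have hcont : ∀ t' ∈ interior Θ, Continuous (smoothedCDF C P Φ ε t') := fun t' ht' =>
    continuous_iff_continuousAt.2 fun r =>
      ((hasFDerivAt_smoothedCDF hC hs hΦ hε ht' r).continuousAt).comp
        (f := fun r' => (t', r')) (Continuous.prodMk_right t').continuousAt
  have hspec := fun t' ht' => quantile_spec (τ := τ) (hcont t' ht')
  have hlim : ContinuousAt (smoothedRadius C P Φ ε τ) t := by
    refine tendsto_sInf_of_tendsto (F := smoothedCDF C P Φ ε t) ?_ (fun r => ?_)
      (hspec t ht hpos).2 hgt
    · exact hint.mono fun t' ht' => monotone_smoothedCDF hC hΦ hε (interior_subset ht')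
    · exact ((hasFDerivAt_smoothedCDF hC hs hΦ hε ht r).continuousAt).comp
        (f := fun t' => (t', r)) (Continuous.prodMk_left r).continuousAt
  -- Continuity keeps nearby radii positive, which excludes the default value of `sInf`.
  have hc : ∀ᶠ t' in 𝓝 t, smoothedCDF C P Φ ε t' (smoothedRadius C P Φ ε τ t') = τ := by
    filter_upwards [hint, hlim.eventually (lt_mem_nhds hpos)] with t' ht' hpos'
    exact (hspec t' ht' hpos').1
  have h := hasFDerivAt_of_implicit (hasFDerivAt_smoothedCDF hC hs hΦ hε ht _) hlim
    (by simpa using ⟨hε.ne', hA⟩) hc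
  rw [hasGradientAt_iff_hasFDerivAt]
  refine h.congr_fderiv (ContinuousLinearMap.ext fun v => ?_)
  simp
  field_simp

end Population

/-! ### The tuned estimator -/

section Estimator

variable {p d : ℕ} {C : Vec p → Set (Vec d)} {Θ : Set (Vec p)} {P : Measure (Vec d)}
  {Φ : ℝ → ℝ} {ε τ ρ : ℝ} {t : Vec p} {Ω : Type*} [MeasurableSpace Ω] {μ : Measure Ω}
  [IsProbabilityMeasure μ] {U : ℕ → Ω → Vec d}

theorem tendsto_empRadius [IsProbabilityMeasure P] (hU : ∀ i, Measurable (U i))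
    (hindep : iIndepFun U μ) (hlaw : ∀ i, Measure.map (U i) μ = P) (hC : GaugeRegular C Θ)
    (hΦ : IsSmoothingCDF Φ) (hε : 0 < ε) (ht : t ∈ Θ)
    (hlt : ∀ r < ρ, smoothedCDF C P Φ ε t r < τ) (hgt : ∀ r, ρ < r → τ < smoothedCDF C P Φ ε t r) :
    Tendsto (fun z : ℕ × Ω => empRadius C Φ ε τ t z.1 (fun i => U i z.2))
      (inProbability μ) (𝓝 ρ) := by
  refine tendsto_sInf_of_tendsto (F := smoothedCDF C P Φ ε t)
    (Eventually.of_forall fun z a b hab => ?_) (fun r => ?_) hlt hgt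
  · exact div_le_div_of_nonneg_right
      (Finset.sum_le_sum fun i _ => hΦ.monotone (by gcongr)) (Nat.cast_nonneg _)
  · have h := tendsto_average_inProbability hU hindep hlaw
      (measurable_kernel (r := r) (ε := ε) hC ht hΦ.contDiff.continuous)
      (integrable_smoothing hC hΦ ht)
    simpa only [empCDF, smoothedCDF, div_eq_inv_mul, smul_eq_mul] using h

/-- Kernel averages with a consistent random radius converge to the population mean. -/
theorem tendsto_kernel_average {E : Type*} [NormedAddCommGroup E] [NormedSpace ℝ E]
    [CompleteSpace E] [MeasurableSpace E] [BorelSpace E] [SecondCountableTopology E]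
    (hU : ∀ i, Measurable (U i)) (hindep : iIndepFun U μ) (hlaw : ∀ i, Measure.map (U i) μ = P)
    (hC : GaugeRegular C Θ) (hΦ : IsSmoothingCDF Φ) (ht : t ∈ Θ)
    {R : ℕ × Ω → ℝ} (hR : Tendsto R (inProbability μ) (𝓝 ρ))
    {g : Vec d → E} (hg : Measurable g) (hgi : Integrable g P) :
    Tendsto (fun z : ℕ × Ω => (z.1 : ℝ)⁻¹ • ∑ i ∈ Finset.range z.1,
        deriv Φ ((R z - score C t (U i z.2)) / ε) • g (U i z.2))
      (inProbability μ) (𝓝 (∫ u, deriv Φ ((ρ - score C t u) / ε) • g u ∂P)) := by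
  have hfix := tendsto_average_inProbability hU hindep hlaw
    ((measurable_kernel (r := ρ) (ε := ε) hC ht hΦ.uniformContinuous.continuous).smul hg)
    (integrable_kernel_smul hC hΦ ht hgi)
  have hnorm := tendsto_average_inProbability hU hindep hlaw hg.norm hgi.norm
  set D₀ := ∫ u, ‖g u‖ ∂P
  have hD₀ : 0 ≤ D₀ := integral_nonneg fun _ => norm_nonneg _
  have hdiff : Tendsto (fun z : ℕ × Ω =>
      ((z.1 : ℝ)⁻¹ • ∑ i ∈ Finset.range z.1,
        deriv Φ ((R z - score C t (U i z.2)) / ε) • g (U i z.2)) -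
      (z.1 : ℝ)⁻¹ • ∑ i ∈ Finset.range z.1,
        deriv Φ ((ρ - score C t (U i z.2)) / ε) • g (U i z.2)) (inProbability μ) (𝓝 0) := by
    rw [Metric.tendsto_nhds]
    intro δ hδ
    -- With probability tending to one the average of `‖g‖` is below `D₀ + 1`, so a uniform error
    -- `κ` in the weights costs less than `δ`.
    set κ := δ / (D₀ + 1)
    have hκ : 0 < κ := by positivity
    obtain ⟨η, hη, huc⟩ := Metric.uniformContinuous_iff.1 hΦ.uniformContinuous κ hκ
    filter_upwards [Metric.tendsto_nhds.1 (hR.div_const ε) η hη,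
      hnorm.eventually_lt_const (lt_add_one D₀)] with z hz hDz
    rw [dist_zero_right, ← smul_sub, ← Finset.sum_sub_distrib, norm_smul,
      Real.norm_of_nonneg (inv_nonneg.2 (Nat.cast_nonneg _))]
    calc (z.1 : ℝ)⁻¹ * ‖∑ i ∈ Finset.range z.1,
          (deriv Φ ((R z - score C t (U i z.2)) / ε) • g (U i z.2) -
            deriv Φ ((ρ - score C t (U i z.2)) / ε) • g (U i z.2))‖
        ≤ (z.1 : ℝ)⁻¹ * ∑ i ∈ Finset.range z.1, κ * ‖g (U i z.2)‖ := by
          refine mul_le_mul_of_nonneg_left (norm_sum_le_of_le _ fun i _ => ?_)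
            (inv_nonneg.2 (Nat.cast_nonneg _))
          rw [← sub_smul, norm_smul]
          refine mul_le_mul_of_nonneg_right ?_ (norm_nonneg _)
          rw [← dist_eq_norm]
          refine (huc ?_).le
          rwa [sub_div, sub_div, dist_sub_right]
      _ = κ * ((z.1 : ℝ)⁻¹ • ∑ i ∈ Finset.range z.1, ‖g (U i z.2)‖) := by
          rw [← Finset.mul_sum, smul_eq_mul]; ring
      _ < κ * (D₀ + 1) := mul_lt_mul_of_pos_left hDz hκ
      _ = δ := div_mul_cancel₀ _ (by positivity)
  simpa using hdiff.add hfix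

theorem tendsto_empSensitivity [IsProbabilityMeasure P] (hU : ∀ i, Measurable (U i))
    (hindep : iIndepFun U μ) (hlaw : ∀ i, Measure.map (U i) μ = P) (hC : GaugeRegular C Θ)
    (hs : ScoreDifferentiable C Θ P) (hΦ : IsSmoothingCDF Φ) (ht : t ∈ interior Θ)
    (hR : Tendsto (fun z : ℕ × Ω => empRadius C Φ ε τ t z.1 (fun i => U i z.2))
      (inProbability μ) (𝓝 ρ)) (hA : meanWeight C P Φ ε t ρ ≠ 0) :
    Tendsto (fun z : ℕ × Ω => empSensitivity C Φ ε τ t z.1 (fun i => U i z.2))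
      (inProbability μ)
      (𝓝 ((meanWeight C P Φ ε t ρ)⁻¹ • meanWeightedGradient C P Φ ε t ρ)) := by
  have htΘ := interior_subset ht
  have hw := tendsto_kernel_average (ε := ε) hU hindep hlaw hC hΦ htΘ hR
    (g := fun _ => (1 : ℝ)) measurable_const (integrable_const _)
  have hwg := tendsto_kernel_average (ε := ε) hU hindep hlaw hC hΦ htΘ hR
    (measurable_gradient_score hC hs ht) (integrable_gradient_score hC hs ht)
  simp only [smul_eq_mul, mul_one] at hw
  refine ((hw.inv₀ hA).smul hwg).congr fun z => ?_
  simp only [empSensitivity, kernelWeight]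
  -- The factors `1/n` cancel in the ratio; for the empty sample both sides are zero.
  rcases Nat.eq_zero_or_pos z.1 with h0 | h0
  · simp [h0]
  · have : (z.1 : ℝ) ≠ 0 := by positivity
    rw [smul_smul, mul_inv, inv_inv, mul_right_comm, mul_inv_cancel₀ this, one_mul]

end Estimator

end ReserveLearning

/-! ### Consistency of the tuned gradient. -/

theorem mainTheorem1 {p d nx m : ℕ}
    -- parameter set, unit sets, robust program
    (Θ : Set (Vec p)) (C : Vec p → Set (Vec d)) (hC : GaugeRegular C Θ)
    (Q : RobustProgram d nx m)
    -- target coverage, bandwidth, shape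
    (τ : ℝ) (hτ : τ ∈ Set.Ioo (0 : ℝ) 1) (ε : ℝ) (hε : 0 < ε)
    (θ : Vec p) (hθ : θ ∈ interior Θ)
    -- (A1) the tuning data are i.i.d. with law `P`
    (P : Measure (Vec d)) [IsProbabilityMeasure P]
    {Ω : Type*} [MeasurableSpace Ω] (Pr : Measure Ω) [IsProbabilityMeasure Pr]
    (U : ℕ → Ω → Vec d) (hU_meas : ∀ i, Measurable (U i))
    (hU_indep : iIndepFun U Pr) (hU_law : ∀ i, Measure.map (U i) Pr = P)
    -- (A2) smoothing kernel and score differentiability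
    (Φ : ℝ → ℝ) (hΦ : IsSmoothingCDF Φ) (hs : ScoreDifferentiable C Θ P)
    -- the smoothed radius at `θ` and its positivity
    (ρ : ℝ) (hρ : ρ = smoothedRadius C P Φ ε τ θ) (hρ_pos : 0 < ρ)
    -- (A3) strict monotonicity near `ρ` and positive smoothed density at `ρ`
    (hF_mono : ∃ N ∈ 𝓝 ρ, StrictMonoOn (smoothedCDF C P Φ ε θ) N)
    (hF_deriv : 0 < deriv (smoothedCDF C P Φ ε θ) ρ)
    -- (A4) `V` is finite near `(θ, ρ)` and differentiable there,
    -- with a unique, continuous dual optimizer nearby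
    (hV_fin : ∀ᶠ z : Vec p × ℝ in 𝓝 (θ, ρ), Q.value C z.1 z.2 ≠ ⊤ ∧ Q.value C z.1 z.2 ≠ ⊥)
    (hV_diff : DifferentiableAt ℝ (fun z : Vec p × ℝ => (Q.value C z.1 z.2).toReal) (θ, ρ))
    (h_dual : ∃ N ∈ 𝓝 ((θ, ρ) : Vec p × ℝ), ∃ ν : Vec p × ℝ → (Fin m → ℝ),
      ContinuousOn ν N ∧ ∀ z ∈ N, Q.optDual C z.1 z.2 = {ν z})
    -- (A5) the shape gradients of the support functions exist and are continuous near `(θ, ρ)`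
    (hσ : ∀ j, ∃ N ∈ 𝓝 ((θ, ρ) : Vec p × ℝ),
      (∀ z ∈ N, DifferentiableAt ℝ (fun t => Q.sigma C j t z.2) z.1) ∧
      ContinuousOn (fun z : Vec p × ℝ => gradient (fun t => Q.sigma C j t z.2) z.1) N)
    -- any choice of dual multipliers of the robust solves at `(θ, ρ̂_ε(θ))`
    (mu : ℕ → Ω → (Fin m → ℝ))
    (hmu : ∀ n ω, 0 < empRadius C Φ ε τ θ n (fun i => U i ω) →
      (Q.optDual C θ (empRadius C Φ ε τ θ n (fun i => U i ω))).Nonempty →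
      mu n ω ∈ Q.optDual C θ (empRadius C Φ ε τ θ n (fun i => U i ω))) :
    -- `J_{P,ε}` is finite near `θ` and differentiable at `θ`
    (∀ᶠ t in 𝓝 θ, smoothedObjective Q C P Φ ε τ t ≠ ⊤ ∧ smoothedObjective Q C P Φ ε τ t ≠ ⊥) ∧
    DifferentiableAt ℝ (fun t => (smoothedObjective Q C P Φ ε τ t).toReal) θ ∧
    -- and the estimator converges in probability to its gradient
    TendstoInMeasure Pr
      (fun n ω => tunedGradient Q C Φ ε τ θ n (fun i => U i ω) (mu n ω)) atTop
      (fun _ => gradient (fun t => (smoothedObjective Q C P Φ ε τ t).toReal) θ) := by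
  subst hρ
  set ρ := smoothedRadius C P Φ ε τ θ with hρ
  obtain ⟨NF, hNF, hNF_mono⟩ := hF_mono
  obtain ⟨ND, hND, ν, hν_cont, hν⟩ := h_dual
  have hθΘ := interior_subset hθ
  have hF := hasFDerivAt_smoothedCDF hC hs hΦ hε hθ
  have hF_ρ : HasDerivAt (smoothedCDF C P Φ ε θ) (ε⁻¹ * meanWeight C P Φ ε θ ρ) ρ := by
    have h : HasFDerivAt (smoothedCDF C P Φ ε θ) _ ρ :=
      HasFDerivAt.comp (f := fun r => (θ, r)) ρ (hF ρ) (hasFDerivAt_prodMk_right θ ρ)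
    simpa using h.hasDerivAt
  have hA : meanWeight C P Φ ε θ ρ ≠ 0 := by
    rw [hF_ρ.deriv] at hF_deriv
    exact (pos_of_mul_pos_right hF_deriv (inv_nonneg.2 hε.le)).ne'
  have hF_cont : Continuous (smoothedCDF C P Φ ε θ) := continuous_iff_continuousAt.2 fun r =>
    (hF r).continuousAt.comp (f := fun r' => (θ, r')) (Continuous.prodMk_right θ).continuousAt
  obtain ⟨hF_eq, hF_lt⟩ := quantile_spec (τ := τ) hF_cont hρ_pos
  have hF_gt : ∀ r, ρ < r → τ < smoothedCDF C P Φ ε θ r := by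
    intro r hr
    -- Strict increase is available only near `ρ`: an intermediate `r'` in that neighbourhood gives
    -- the strict inequality, and monotonicity carries it to `r`.
    have hNF' : ∀ᶠ r' in 𝓝[>] ρ, r' ∈ NF := nhdsWithin_le_nhds hNF
    obtain ⟨r', hr'N, hr'⟩ := (hNF'.and (Ioo_mem_nhdsGT hr)).exists
    calc τ = smoothedCDF C P Φ ε θ ρ := hF_eq.symm
      _ < smoothedCDF C P Φ ε θ r' := hNF_mono (mem_of_mem_nhds hNF) hr'N hr'.1
      _ ≤ smoothedCDF C P Φ ε θ r := monotone_smoothedCDF hC hΦ hε hθΘ hr'.2.le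
  have hgrad := hasGradientAt_smoothedRadius hC hs hΦ hε hθ hρ_pos hF_gt hA
  have hpair : ContinuousAt (fun t => (t, smoothedRadius C P Φ ε τ t)) θ :=
    continuousAt_id.prodMk hgrad.continuousAt
  have hν0 := hν _ (mem_of_mem_nhds hND)
  have hσ0 : ∀ j, DifferentiableAt ℝ (fun t => Q.sigma C j t ρ) θ := fun j => by
    obtain ⟨N, hN, hd, -⟩ := hσ j
    exact hd _ (mem_of_mem_nhds hN)
  have hσ_cont : ∀ j, ContinuousAt
      (fun z : Vec p × ℝ => gradient (fun t => Q.sigma C j t z.2) z.1) (θ, ρ) := fun j => by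
    obtain ⟨N, hN, -, hc⟩ := hσ j
    exact hc.continuousAt hN
  have hV := Q.hasFDerivAt_value hρ_pos hV_fin hV_diff hν0 hσ0
  have hJ : HasGradientAt (fun t => (smoothedObjective Q C P Φ ε τ t).toReal)
      ((∑ j, ν (θ, ρ) j • gradient (fun t => Q.sigma C j t ρ) θ) +
        (∑ j, ν (θ, ρ) j * Q.sigma C j θ 1) •
          ((meanWeight C P Φ ε θ ρ)⁻¹ • meanWeightedGradient C P Φ ε θ ρ)) θ := by
    have h := HasFDerivAt.comp (f := fun t => (t, smoothedRadius C P Φ ε τ t)) θ hV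
      ((hasFDerivAt_id θ).prodMk hgrad.hasFDerivAt)
    refine hasGradientAt_iff_hasFDerivAt.2 (h.congr_fderiv (ContinuousLinearMap.ext fun v => ?_))
    simp [← hρ]
  refine ⟨hpair.eventually hV_fin, hJ.differentiableAt, ?_⟩
  rw [hJ.gradient, tendstoInMeasure_const_iff]
  have hR := tendsto_empRadius hU_meas hU_indep hU_law hC hΦ hε hθΘ hF_lt hF_gt
  have hS := tendsto_empSensitivity hU_meas hU_indep hU_law hC hs hΦ hθ hR hA
  have hθR : Tendsto (fun z : ℕ × Ω => (θ, empRadius C Φ ε τ θ z.1 (fun i => U i z.2)))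
      (inProbability Pr) (𝓝 (θ, ρ)) := tendsto_const_nhds.prodMk_nhds hR
  have hmu_lim : Tendsto (fun z : ℕ × Ω => mu z.1 z.2) (inProbability Pr) (𝓝 (ν (θ, ρ))) := by
    -- The chosen multipliers equal `ν (θ, ρ̂)` once `ρ̂ > 0` and `(θ, ρ̂)` lies in `ND`, an event
    -- of probability tending to one; elsewhere they are irrelevant.
    refine ((hν_cont.continuousAt hND).tendsto.comp hθR).congr' ?_
    filter_upwards [hθR.eventually hND, hR.eventually (lt_mem_nhds hρ_pos)] with z hz hz0
    have h := hmu z.1 z.2 hz0 (by rw [hν _ hz]; exact Set.singleton_nonempty _)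
    rw [hν _ hz] at h
    exact h.symm
  have hmu_j := tendsto_pi_nhds.1 hmu_lim
  exact (tendsto_finsetSum _ fun j _ => (hmu_j j).smul ((hσ_cont j).tendsto.comp hθR)).add
    ((tendsto_finsetSum _ fun j _ => (hmu_j j).mul_const _).smul hS)
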